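/- Theorem ($\Delta$-interpolation and separation). Let $\tau$ be a signature (a set of relation, function and constant symbols with arities), and consider first-order logic with equality. A $\tau$-structure is a nonempty set, possibly infinite, with interpretations of the symbols of $\tau$. An $\exists\mathrm{SO}$-sentence (respectively, $\forall\mathrm{SO}$-sentence) over $\tau$ is an expression $\exists X_1\ldots\exists X_n.\,\phi$ (respectively, $\forall X_1\ldots\forall X_n.\,\phi$), where $n\ge 0$, $X_1,\ldots,X_n$ are relation variables of arbitrary finite arities, ranging over all relations of the given arities on the domain, and $\phi$ is a first-order sentence over $\tau\cup\{X_1,\ldots,X_n\}$. A class of $\tau$-structures is definable by a sentence if it consists exactly of those $\tau$-structures in which the sentence is true; it is FO-, $\exists\mathrm{SO}$- or $\forall\mathrm{SO}$-definable if it is definable by a first-order sentence, an $\exists\mathrm{SO}$-sentence or a $\forall\mathrm{SO}$-sentence over $\tau$, respectively. 1. If a class $K$ of $\tau$-structures is both $\exists\mathrm{SO}$-definable and $\forall\mathrm{SO}$-definable, then $K$ is FO-definable. 2. If $K\subseteq K'$, where $K$ is an $\exists\mathrm{SO}$-definable and $K'$ a $\forall\mathrm{SO}$-definable class of $\tau$-structures,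 then there is an FO-definable class $K''$ of $\tau$-structures with $K\subseteq K''\subseteq K'$. -/

import Mathlib

universe u v w

namespace SecondOrder

open FirstOrder

/-- The signature consisting of `n` relation variables `X₀, …, Xₙ₋₁`, where `Xᵢ` has arity
`arity i`; there are no function or constant symbols. -/
def relVars {n : ℕ} (arity : Fin n → ℕ) : FirstOrder.Language.{0, 0} where
  Functions := fun _ => Empty
  Relations := fun k => {i : Fin n // arity i = k}

/-- The interpretation of the relation variables `Xᵢ` by given relations `R i` on `M`. -/
@[reducible]
def assignment {n : ℕ} {arity : Fin n → ℕ} {M : Type w}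
    (R : (i : Fin n) → (Fin (arity i) → M) → Prop) : (relVars arity).Structure M where
  funMap := fun f _ => Empty.elim f
  RelMap := fun X xs => R X.1 (fun j => xs (Fin.cast X.2 j))

/-- An `L`-structure `M`, together with relations `R i` on `M` interpreting the variables `Xᵢ`,
satisfies the first-order sentence `φ` over the signature `L ∪ {X₀, …, Xₙ₋₁}`. -/
def SatisfiesMatrix {L : FirstOrder.Language.{u, v}} {n : ℕ} {arity : Fin n → ℕ}
    (φ : (L.sum (relVars arity)).Sentence) (M : Type w) [L.Structure M]
    (R : (i : Fin n) → (Fin (arity i) → M) → Prop) : Prop :=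
  letI : (relVars arity).Structure M := assignment R
  M ⊨ φ

/-- An existential second-order sentence `∃ X₀ … ∃ Xₙ₋₁. φ` over `L`, with `φ` first-order over
`L ∪ {X₀, …, Xₙ₋₁}`. -/
structure ExistsSOSentence (L : FirstOrder.Language.{u, v}) where
  n : ℕ
  arity : Fin n → ℕ
  matrix : (L.sum (relVars arity)).Sentence

/-- Truth of an existential second-order sentence in a structure. -/
def ExistsSOSentence.Realize {L : FirstOrder.Language.{u, v}} (Φ : ExistsSOSentence L)
    (M : Type w) [L.Structure M] : Prop :=
  ∃ R : (i : Fin Φ.n) → (Fin (Φ.arity i) → M) → Prop, SatisfiesMatrix Φ.matrix M R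

/-- A universal second-order sentence `∀ X₀ … ∀ Xₙ₋₁. φ` over `L`, with `φ` first-order over
`L ∪ {X₀, …, Xₙ₋₁}`. -/
structure ForallSOSentence (L : FirstOrder.Language.{u, v}) where
  n : ℕ
  arity : Fin n → ℕ
  matrix : (L.sum (relVars arity)).Sentence

/-- Truth of a universal second-order sentence in a structure. -/
def ForallSOSentence.Realize {L : FirstOrder.Language.{u, v}} (Ψ : ForallSOSentence L)
    (M : Type w) [L.Structure M] : Prop :=
  ∀ R : (i : Fin Ψ.n) → (Fin (Ψ.arity i) → M) → Prop, SatisfiesMatrix Ψ.matrix M R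

/-- Classes of `L`-structures. The elements of the underlying type are the `L`-structures with a
nonempty domain, i.e. Mathlib's bundled nonempty models of the empty theory. -/
abbrev StructureClass (L : FirstOrder.Language.{u, v}) : Type (max u v (w + 1)) :=
  Set (FirstOrder.Language.Theory.ModelType.{u, v, w} (∅ : L.Theory))

/-- `K` is the class of models of some first-order sentence over `L`. -/
def FODefinable {L : FirstOrder.Language.{u, v}} (K : StructureClass.{u, v, w} L) : Prop :=
  ∃ θ : L.Sentence, ∀ M, M ∈ K ↔ M ⊨ θ

/-- `K` is the class of models of some existential second-order sentence over `L`. -/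
def ExistsSODefinable {L : FirstOrder.Language.{u, v}} (K : StructureClass.{u, v, w} L) : Prop :=
  ∃ Φ : ExistsSOSentence L, ∀ M, M ∈ K ↔ Φ.Realize M

/-- `K` is the class of models of some universal second-order sentence over `L`. -/
def ForallSODefinable {L : FirstOrder.Language.{u, v}} (K : StructureClass.{u, v, w} L) : Prop :=
  ∃ Ψ : ForallSOSentence L, ∀ M, M ∈ K ↔ Ψ.Realize M

end SecondOrder

/-! Let `∃X. φ` define `K` and `∀Y. ψ` define `K'`. A structure with relations `X` and `Y`
satisfying `φ` and `¬ψ` would lie in `K` but not in `K'`. Hence `φ` and `¬ψ` have no common model,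
and Craig interpolation (`exists_separating_sentence`) yields a first-order `θ` over the base
signature with `φ ⊨ θ` and `¬ψ ⊨ ¬θ`; its models form `K''`. Part 1 is the case `K = K'`.

Interpolation is proved contrapositively by a Henkin construction. An inseparable pair is
strengthened in countably many steps (`Inseparable.exists_isGeneric`) until each side decides all
its formulas and names its existential witnesses. Inseparability forces both sides to agree on the
common language, so their term models share a reduct (`Inseparable.exists_common_model`).

A formula uses finitely many symbols, so countable languages suffice. The models then live on a
quotient of `ℕ`, which exists in every universe, whatever the universes of the signature. -/

namespace FirstOrder.Language

open Formula

universe u₀ v₀ u₁ v₁ u₂ v₂ u'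

/-! ### Entailment between formulas and compactness -/

section Entailment

variable {L : Language.{u, v}} {α : Type u'}

/-- `φ.Entails ψ` means that every assignment satisfying `φ` also satisfies `ψ`. -/
def Formula.Entails (φ ψ : L.Formula α) : Prop := (∅ : L.Theory) ⊨ᵇ φ.imp ψ

theorem Formula.Entails.realize {φ ψ : L.Formula α} (h : φ.Entails ψ) {M : Type*} [L.Structure M]
    [Nonempty M] {v : α → M} (hφ : φ.Realize v) : ψ.Realize v :=
  Formula.realize_imp.1 (Theory.ModelsBoundedFormula.realize_formula h M (v := v)) hφ

theorem Formula.entails_of_realize {φ ψ : L.Formula α}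
    (h : ∀ (M : Type max u v u') [L.Structure M] [Nonempty M] (v : α → M),
      φ.Realize v → ψ.Realize v) : φ.Entails ψ :=
  Theory.models_formula_iff.2 fun M v => Formula.realize_imp.2 (h M v)

theorem Formula.Entails.refl (φ : L.Formula α) : φ.Entails φ :=
  entails_of_realize fun _ _ _ _ h => h

theorem Formula.Entails.trans {φ ψ χ : L.Formula α} (h : φ.Entails ψ) (h' : ψ.Entails χ) :
    φ.Entails χ :=
  entails_of_realize fun _ _ _ _ hφ => h'.realize (h.realize hφ)

theorem Formula.inf_entails_left (φ ψ : L.Formula α) : (φ ⊓ ψ).Entails φ :=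
  entails_of_realize fun _ _ _ _ h => (Formula.realize_inf.1 h).1

theorem Formula.inf_entails_right (φ ψ : L.Formula α) : (φ ⊓ ψ).Entails ψ :=
  entails_of_realize fun _ _ _ _ h => (Formula.realize_inf.1 h).2

theorem Formula.realize_congr_freeVarFinset [DecidableEq α] {M : Type*} [L.Structure M]
    (φ : L.Formula α) {v v' : α → M} (h : ∀ a ∈ φ.freeVarFinset, v a = v' a) :
    φ.Realize v ↔ φ.Realize v' := by
  have h₁ := BoundedFormula.realize_restrictFreeVar (φ := φ) (f := id)
    (v := fun a => v a) (xs := default) v fun _ => rfl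
  have h₂ := BoundedFormula.realize_restrictFreeVar (φ := φ) (f := id)
    (v := fun a => v a) (xs := default) v' fun a => h a a.2
  exact h₁.symm.trans h₂

theorem Formula.realize_iExs_unit {M : Type*} [L.Structure M] {φ : L.Formula (α ⊕ Unit)}
    {v : α → M} : (φ.iExs Unit).Realize v ↔ ∃ a, φ.Realize (Sum.elim v fun _ => a) :=
  Formula.realize_iExs.trans ⟨fun ⟨w, hw⟩ => ⟨w (), hw⟩, fun ⟨_, ha⟩ => ⟨_, ha⟩⟩

/-- Quantify existentially over one of the free variables. -/
noncomputable def Formula.exVar [DecidableEq α] (φ : L.Formula α) (k : α) : L.Formula α :=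
  iExs Unit (φ.relabel fun n => if n = k then Sum.inr () else Sum.inl n)

theorem Formula.realize_exVar [DecidableEq α] {M : Type*} [L.Structure M] {φ : L.Formula α}
    {k : α} {v : α → M} :
    (φ.exVar k).Realize v ↔ ∃ a, φ.Realize (Function.update v k a) := by
  rw [Formula.exVar, Formula.realize_iExs_unit]
  refine exists_congr fun a => ?_
  rw [Formula.realize_relabel]
  refine iff_of_eq (congrArg φ.Realize (funext fun n => ?_))
  by_cases h : n = k <;> simp [h]

theorem Sentence.formulaRealize_iff {M : Type*} [L.Structure M] (φ : L.Sentence) (v : Empty → M) :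
    Formula.Realize φ v ↔ M ⊨ φ := by
  rw [Sentence.Realize, Subsingleton.elim v default]

/-- Compactness for a sequence of formulas that grow stronger. -/
theorem exists_realize_of_antitone (s : ℕ → L.Formula α)
    (hs : ∀ m n, m ≤ n → (s n).Entails (s m)) (hsat : ∀ n, ¬ (s n).Entails ⊥) :
    ∃ (M : Type max u v u') (_ : L.Structure M) (_ : Nonempty M) (v : α → M),
      ∀ n, (s n).Realize v := by
  -- Free variables become constants. Each stage collects all earlier formulas, so the union is
  -- directed and stagewise satisfiability suffices.
  let T : ℕ → L[[α]].Theory := fun n => (fun m => equivSentence (s m)) '' Set.Iic n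
  have hT : Monotone T := fun m n h => Set.image_mono (Set.Iic_subset_Iic.2 h)
  have hsat : Theory.IsSatisfiable (⋃ n, T n) := by
    rw [Theory.isSatisfiable_directed_union_iff hT.directed_le]
    intro n
    by_contra hn
    refine hsat n (entails_of_realize fun M _ _ v h => (hn ?_).elim)
    let : (constantsOn α).Structure M := constantsOn.structure v
    have : M ⊨ T n := by
      rw [Theory.model_iff]
      rintro _ ⟨m, hm, rfl⟩
      exact (realize_equivSentence M (s m)).2 ((hs m n hm).realize h)
    exact Theory.Model.isSatisfiable M
  obtain ⟨M⟩ := hsat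
  let := (L.lhomWithConstants α).reduct M
  refine ⟨M, inferInstance, inferInstance, fun a => (L.con a : M), fun n => ?_⟩
  rw [← realize_equivSentence]
  exact Theory.realize_sentence_of_mem (⋃ n, T n)
    (Set.mem_iUnion.2 ⟨n, n, Set.mem_Iic.2 le_rfl, rfl⟩)

end Entailment

/-! ### Inseparable pairs of formulas -/

section Separation

variable {L₀ : Language.{u₀, v₀}} {L₁ : Language.{u₁, v₁}} {L₂ : Language.{u₂, v₂}}
variable {i : L₀ →ᴸ L₁} {j : L₀ →ᴸ L₂}

/-- No formula over the common language `L₀` follows from `φ` while its negation follows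
from `ψ`. -/
def Inseparable (i : L₀ →ᴸ L₁) (j : L₀ →ᴸ L₂) {α : Type u'} (φ : L₁.Formula α)
    (ψ : L₂.Formula α) : Prop :=
  ∀ θ : L₀.Formula α, φ.Entails (i.onFormula θ) → ¬ ψ.Entails (j.onFormula θ).not

namespace Inseparable

variable {α : Type u'} {φ : L₁.Formula α} {ψ : L₂.Formula α}

theorem symm (h : Inseparable i j φ ψ) : Inseparable j i ψ φ := by
  intro θ hψ hφ
  refine h θ.not (hφ.trans ?_) (hψ.trans ?_)
  · exact entails_of_realize fun M _ _ v hv => hv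
  · exact entails_of_realize fun M _ _ v hv => Formula.realize_not.2 fun hv' =>
      (Formula.realize_not.1 hv' : ¬ (j.onFormula θ).Realize v) hv

theorem not_entails_bot (h : Inseparable i j φ ψ) : ¬ φ.Entails ⊥ := by
  intro hφ
  refine h ⊥ (hφ.trans (entails_of_realize fun M _ _ v hv => hv.elim)) ?_
  exact entails_of_realize fun M _ _ v _ => Formula.realize_not.2 fun hv => hv

/-- If `θ₁` separates the extension by `χ` and `θ₂` the one by `¬χ`, then `θ₁ ⊔ θ₂` already
separates the original pair. -/
theorem inf_or_inf_not (h : Inseparable i j φ ψ) (χ : L₁.Formula α) :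
    Inseparable i j (φ ⊓ χ) ψ ∨ Inseparable i j (φ ⊓ χ.not) ψ := by
  by_contra! hc
  simp only [Inseparable, not_forall, not_not] at hc
  obtain ⟨⟨θ₁, h₁, h₁'⟩, θ₂, h₂, h₂'⟩ := hc
  refine h (θ₁ ⊔ θ₂) (entails_of_realize fun M _ _ v hv => ?_)
    (entails_of_realize fun M _ _ v hv => ?_)
  · let := i.reduct M
    rw [LHom.realize_onFormula, Formula.realize_sup]
    by_cases hχ : χ.Realize v
    · exact Or.inl ((LHom.realize_onFormula ..).1 (h₁.realize (Formula.realize_inf.2 ⟨hv, hχ⟩)))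
    · exact Or.inr ((LHom.realize_onFormula ..).1 (h₂.realize (Formula.realize_inf.2 ⟨hv, hχ⟩)))
  · let := j.reduct M
    have h₁ := h₁'.realize hv
    have h₂ := h₂'.realize hv
    rw [Formula.realize_not, LHom.realize_onFormula] at h₁ h₂ ⊢
    rw [Formula.realize_sup]
    exact fun h => h.elim h₁ h₂

/-- An existential quantifier may be witnessed by a fresh variable. -/
theorem exists_witness {φ : L₁.Formula ℕ} {ψ : L₂.Formula ℕ} {χ : L₁.Formula (ℕ ⊕ Unit)}
    (h : Inseparable i j (φ ⊓ χ.iExs Unit) ψ) :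
    ∃ k : ℕ, Inseparable i j (φ ⊓ χ.relabel (Sum.elim id fun _ => k)) ψ := by
  obtain ⟨k, hk⟩ := Infinite.exists_notMem_finset
    (φ.freeVarFinset ∪ ψ.freeVarFinset ∪ χ.freeVarFinset.toLeft)
  simp only [Finset.mem_union, Finset.mem_toLeft, not_or] at hk
  obtain ⟨⟨hφ, hψ⟩, hχ⟩ := hk
  refine ⟨k, fun θ h₁ h₂ => ?_⟩
  -- As `k` is free in none of the three formulas, a separator after naming the witness becomes a
  -- separator before it by quantifying `k` away.
  refine h (θ.exVar k) (entails_of_realize fun M _ _ v hv => ?_)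
    (entails_of_realize fun M _ _ v hv => ?_)
  · let := i.reduct M
    rw [Formula.realize_inf, Formula.realize_iExs_unit] at hv
    obtain ⟨hv, a, ha⟩ := hv
    rw [LHom.realize_onFormula, Formula.realize_exVar]
    refine ⟨a, (LHom.realize_onFormula ..).1 (h₁.realize (Formula.realize_inf.2 ⟨?_, ?_⟩))⟩
    · refine (φ.realize_congr_freeVarFinset fun n hn => ?_).1 hv
      rw [Function.update_of_ne (ne_of_mem_of_not_mem hn hφ)]
    · rw [Formula.realize_relabel]
      refine (χ.realize_congr_freeVarFinset ?_).1 ha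
      rintro (n | _) hn
      · have hnk : n ≠ k := by
          rintro rfl
          exact hχ hn
        simp [hnk]
      · simp
  · let := j.reduct M
    rw [Formula.realize_not, LHom.realize_onFormula, Formula.realize_exVar]
    rintro ⟨a, ha⟩
    have hv' := (ψ.realize_congr_freeVarFinset (v' := Function.update v k a) fun n hn => by
      rw [Function.update_of_ne (ne_of_mem_of_not_mem hn hψ)]).1 hv
    exact Formula.realize_not.1 (h₂.realize hv') ((LHom.realize_onFormula ..).2 ha)

end Inseparable

end Separation

/-! ### Generic sequences and their countable models -/

section Generic

variable {L : Language.{u, v}}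

/-- A sequence of formulas growing stronger that decides every formula and names a witness for
every existential statement. -/
structure IsGeneric (s : ℕ → L.Formula ℕ) : Prop where
  entails_of_le : ∀ m n, m ≤ n → (s n).Entails (s m)
  consistent : ∀ n, ¬ (s n).Entails ⊥
  decides : ∀ χ : L.Formula ℕ, ∃ n, (s n).Entails χ ∨ (s n).Entails χ.not
  witness : ∀ χ : L.Formula (ℕ ⊕ Unit), ∃ n, (s n).Entails (χ.iExs Unit).not ∨
    ∃ k : ℕ, (s n).Entails (χ.relabel (Sum.elim id fun _ => k))

/-- A form of the Tarski–Vaught test for the range of a sequence. -/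
theorem exists_elementarySubstructure_range {M : Type w} [L.Structure M] (v : ℕ → M)
    (hv : ∀ χ : L.Formula (ℕ ⊕ Unit), (∃ a, χ.Realize (Sum.elim v fun _ => a)) →
      ∃ k, χ.Realize (Sum.elim v fun _ => v k)) :
    ∃ S : L.ElementarySubstructure M, ∀ a, a ∈ S ↔ a ∈ Set.range v := by
  let S : L.Substructure M :=
    { carrier := Set.range v
      fun_mem := by
        intro n f xs hxs
        choose ι hι using hxs
        -- Closure under `f` is the witness property for the formula `f(x) = y`.
        obtain ⟨k, hk⟩ := hv
          ((Term.func f fun l => Term.var (Sum.inl (ι l))).equal (Term.var (Sum.inr ())))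
          ⟨Structure.funMap f xs, by simp [hι]⟩
        refine ⟨k, ?_⟩
        simpa [hι] using hk.symm }
  refine ⟨S.toElementarySubstructure fun n φ x a ha => ?_, fun a => Iff.rfl⟩
  choose ι hι using fun l => (x l).2
  let g : Empty ⊕ Fin (n + 1) → ℕ ⊕ Unit :=
    Sum.elim Empty.elim (Fin.lastCases (Sum.inr ()) fun l => Sum.inl (ι l))
  have hg : ∀ b, (φ.toFormula.relabel g).Realize (Sum.elim v fun _ => b) ↔
      φ.Realize default (Fin.snoc ((↑) ∘ x) b : _ → M) := by
    intro b
    rw [Formula.realize_relabel, BoundedFormula.realize_toFormula]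
    refine iff_of_eq (congrArg₂ φ.Realize (Subsingleton.elim _ _) (funext fun l => ?_))
    refine Fin.lastCases ?_ (fun l => ?_) l
    · simp [g]
    · simp [g, hι]
  obtain ⟨k, hk⟩ := hv _ ⟨a, (hg a).2 ha⟩
  exact ⟨⟨v k, k, rfl⟩, (hg _).1 hk⟩

/-- Compactness realizes the whole sequence; the named witnesses make the range of the assignment an
elementary substructure, and decidedness turns truth there into entailment at some stage. -/
theorem IsGeneric.exists_model {s : ℕ → L.Formula ℕ} (hs : IsGeneric s) :
    ∃ (M : Type max u v) (_ : L.Structure M) (v : ℕ → M), Function.Surjective v ∧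
      ∀ χ : L.Formula ℕ, χ.Realize v ↔ ∃ n, (s n).Entails χ := by
  obtain ⟨M, _, _, v, hv⟩ := exists_realize_of_antitone s hs.entails_of_le hs.consistent
  obtain ⟨S, hS⟩ := exists_elementarySubstructure_range v fun χ hχ => by
    obtain ⟨n, hn | ⟨k, hk⟩⟩ := hs.witness χ
    · exact (Formula.realize_not.1 (hn.realize (hv n)) (Formula.realize_iExs_unit.2 hχ)).elim
    · refine ⟨k, ?_⟩
      have := Formula.realize_relabel.1 (hk.realize (hv n))
      refine (iff_of_eq (congrArg χ.Realize (funext ?_))).1 this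
      rintro (n | _) <;> rfl
  refine ⟨S, inferInstance, fun n => ⟨v n, (hS _).2 ⟨n, rfl⟩⟩, ?_, fun χ => ?_⟩
  · rintro ⟨a, ha⟩
    obtain ⟨n, rfl⟩ := (hS a).1 ha
    exact ⟨n, rfl⟩
  · refine (S.subtype.map_formula χ _).symm.trans ⟨fun h => ?_, fun ⟨n, hn⟩ => hn.realize (hv n)⟩
    obtain ⟨n, hn | hn⟩ := hs.decides χ
    · exact ⟨n, hn⟩
    · exact (Formula.realize_not.1 (hn.realize (hv n)) h).elim

/-- The model determined by a generic sequence lives on a quotient of `ℕ`. -/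
theorem IsGeneric.exists_model_quotient {s : ℕ → L.Formula ℕ} (hs : IsGeneric s) (r : Setoid ℕ)
    (hr : ∀ a b, r a b ↔ ∃ n, (s n).Entails ((Term.var a).equal (Term.var b))) :
    ∃ _ : L.Structure (ULift.{w} (Quotient r)), ∀ χ : L.Formula ℕ,
      χ.Realize (fun n => ULift.up (Quotient.mk r n)) ↔ ∃ n, (s n).Entails χ := by
  obtain ⟨M, _, v, hv, hM⟩ := hs.exists_model
  obtain rfl : Setoid.ker v = r := by
    ext a b
    rw [hr, ← hM]
    simp [Setoid.ker_def]
  let e : M ≃ ULift.{w} (Quotient (Setoid.ker v)) :=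
    (Setoid.quotientKerEquivOfSurjective v hv).symm.trans Equiv.ulift.symm
  let := e.inducedStructure (L := L)
  refine ⟨inferInstance, fun χ => ?_⟩
  rw [← hM, ← StrongHomClass.realize_formula (e.inducedStructureEquiv (L := L))]
  refine iff_of_eq (congrArg χ.Realize (funext fun n => ?_))
  refine congrArg ULift.up ?_
  exact ((Setoid.quotientKerEquivOfSurjective v hv).symm_apply_apply _).symm

end Generic

/-! ### Craig interpolation for countable languages -/

section Interpolation

variable {L₀ : Language.{u₀, v₀}} {L₁ : Language.{u₁, v₁}} {L₂ : Language.{u₂, v₂}}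

/-- Inseparable pairs of formulas, ordered by strength. -/
def InseparablePair (i : L₀ →ᴸ L₁) (j : L₀ →ᴸ L₂) :=
  {p : L₁.Formula ℕ × L₂.Formula ℕ // Inseparable i j p.1 p.2}

instance (i : L₀ →ᴸ L₁) (j : L₀ →ᴸ L₂) : Preorder (InseparablePair i j) where
  le p q := q.1.1.Entails p.1.1 ∧ q.1.2.Entails p.1.2
  le_refl p := ⟨.refl _, .refl _⟩
  le_trans p q r hpq hqr := ⟨hqr.1.trans hpq.1, hqr.2.trans hpq.2⟩

variable {i : L₀ →ᴸ L₁} {j : L₀ →ᴸ L₂}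

theorem Inseparable.exists_decides {φ : L₁.Formula ℕ} {ψ : L₂.Formula ℕ}
    (h : Inseparable i j φ ψ) (χ : L₁.Formula ℕ) :
    ∃ φ', φ'.Entails φ ∧ Inseparable i j φ' ψ ∧ (φ'.Entails χ ∨ φ'.Entails χ.not) := by
  rcases h.inf_or_inf_not χ with h | h
  · exact ⟨_, inf_entails_left _ _, h, Or.inl (inf_entails_right _ _)⟩
  · exact ⟨_, inf_entails_left _ _, h, Or.inr (inf_entails_right _ _)⟩

theorem Inseparable.exists_decides_witness {φ : L₁.Formula ℕ} {ψ : L₂.Formula ℕ}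
    (h : Inseparable i j φ ψ) (χ : L₁.Formula (ℕ ⊕ Unit)) :
    ∃ φ', φ'.Entails φ ∧ Inseparable i j φ' ψ ∧ (φ'.Entails (χ.iExs Unit).not ∨
      ∃ k : ℕ, φ'.Entails (χ.relabel (Sum.elim id fun _ => k))) := by
  rcases h.inf_or_inf_not (χ.iExs Unit) with h | h
  · obtain ⟨k, hk⟩ := h.exists_witness
    exact ⟨_, inf_entails_left _ _, hk, Or.inr ⟨k, inf_entails_right _ _⟩⟩
  · exact ⟨_, inf_entails_left _ _, h, Or.inl (inf_entails_right _ _)⟩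

/-- Each requirement, on either side, is met by a cofinal set of inseparable pairs. There are
countably many, so one increasing sequence meets them all. -/
theorem Inseparable.exists_isGeneric [Countable L₁.Symbols] [Countable L₂.Symbols]
    {φ : L₁.Formula ℕ} {ψ : L₂.Formula ℕ} (h : Inseparable i j φ ψ) :
    ∃ (s : ℕ → L₁.Formula ℕ) (t : ℕ → L₂.Formula ℕ), IsGeneric s ∧ IsGeneric t ∧
      s 0 = φ ∧ t 0 = ψ ∧ ∀ n, Inseparable i j (s n) (t n) := by
  let ι := (L₁.Formula ℕ ⊕ L₁.Formula (ℕ ⊕ Unit)) ⊕ (L₂.Formula ℕ ⊕ L₂.Formula (ℕ ⊕ Unit))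
  let : Encodable ι := Encodable.ofCountable ι
  let D : ι → Order.Cofinal (InseparablePair i j) := Sum.elim
    (Sum.elim
      (fun χ => ⟨{p | p.1.1.Entails χ ∨ p.1.1.Entails χ.not}, fun p => by
        obtain ⟨φ', h₁, h₂, h₃⟩ := p.2.exists_decides χ
        exact ⟨⟨(φ', p.1.2), h₂⟩, h₃, h₁, .refl _⟩⟩)
      (fun χ => ⟨{p | p.1.1.Entails (χ.iExs Unit).not ∨
          ∃ k : ℕ, p.1.1.Entails (χ.relabel (Sum.elim id fun _ => k))}, fun p => by
        obtain ⟨φ', h₁, h₂, h₃⟩ := p.2.exists_decides_witness χ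
        exact ⟨⟨(φ', p.1.2), h₂⟩, h₃, h₁, .refl _⟩⟩))
    (Sum.elim
      (fun χ => ⟨{p | p.1.2.Entails χ ∨ p.1.2.Entails χ.not}, fun p => by
        obtain ⟨φ', h₁, h₂, h₃⟩ := p.2.symm.exists_decides χ
        exact ⟨⟨(p.1.1, φ'), h₂.symm⟩, h₃, .refl _, h₁⟩⟩)
      (fun χ => ⟨{p | p.1.2.Entails (χ.iExs Unit).not ∨
          ∃ k : ℕ, p.1.2.Entails (χ.relabel (Sum.elim id fun _ => k))}, fun p => by
        obtain ⟨φ', h₁, h₂, h₃⟩ := p.2.symm.exists_decides_witness χ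
        exact ⟨⟨(p.1.1, φ'), h₂.symm⟩, h₃, .refl _, h₁⟩⟩))
  let p : ℕ → InseparablePair i j :=
    Order.sequenceOfCofinals (P := InseparablePair i j) ⟨(φ, ψ), h⟩ D
  have hp : Monotone p := Order.sequenceOfCofinals.monotone _ D
  have hD : ∀ a, ∃ n, p n ∈ D a := fun a => ⟨_, Order.sequenceOfCofinals.encode_mem _ D a⟩
  exact ⟨fun n => (p n).1.1, fun n => (p n).1.2,
    ⟨fun m n hmn => (hp hmn).1, fun n => (p n).2.not_entails_bot,
      fun χ => hD (Sum.inl (Sum.inl χ)), fun χ => hD (Sum.inl (Sum.inr χ))⟩,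
    ⟨fun m n hmn => (hp hmn).2, fun n => (p n).2.symm.not_entails_bot,
      fun χ => hD (Sum.inr (Sum.inl χ)), fun χ => hD (Sum.inr (Sum.inr χ))⟩,
    rfl, rfl, fun n => (p n).2⟩

/-- Structures over two languages that satisfy the same formulas over the common language, under
assignments onto the domain, have the same reduct. -/
theorem reduct_eq_of_realize_iff {N : Type w} {α : Type u'} (s₁ : L₁.Structure N)
    (s₂ : L₂.Structure N) (v : α → N) (hv : Function.Surjective v)
    (h : ∀ θ : L₀.Formula α, (i.onFormula θ).Realize v ↔ (j.onFormula θ).Realize v) :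
    i.reduct N = j.reduct N := by
  have h' : ∀ θ : L₀.Formula α, @Formula.Realize _ N (i.reduct N) _ θ v ↔
      @Formula.Realize _ N (j.reduct N) _ θ v := fun θ =>
    (@LHom.realize_onFormula _ _ N (i.reduct N) _ s₁ i _ θ v).symm.trans
      ((h θ).trans (@LHom.realize_onFormula _ _ N (j.reduct N) _ s₂ j _ θ v))
  ext n f xs
  · choose a ha using fun l => hv (xs l)
    obtain rfl : (fun l => v (a l)) = xs := funext ha
    -- Surjectivity names the value by a variable, so the graph of `f` is read off from formulas.
    obtain ⟨c, hc⟩ := hv (@Structure.funMap _ N (i.reduct N) n f fun l => v (a l))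
    have := (h' ((Term.func f fun l => Term.var (a l)).equal (Term.var c))).1
      (by
        let := i.reduct N
        rw [Formula.realize_equal]
        exact hc.symm)
    have := (@Formula.realize_equal _ N (j.reduct N) _ _ _ _).1 this
    exact hc.symm.trans this.symm
  · choose a ha using fun l => hv (xs l)
    obtain rfl : (fun l => v (a l)) = xs := funext ha
    have := h' (Relations.formula f fun l => Term.var (a l))
    rw [@Formula.realize_rel, @Formula.realize_rel] at this
    exact this

/-- Inseparable formulas over countable languages are satisfied together in a structure for the
union of the two languages. -/
theorem Inseparable.exists_common_model [Countable L₁.Symbols] [Countable L₂.Symbols]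
    {φ : L₁.Formula ℕ} {ψ : L₂.Formula ℕ} (h : Inseparable i j φ ψ) :
    ∃ (N : Type w) (_ : L₁.Structure N) (_ : L₂.Structure N) (v : ℕ → N),
      i.reduct N = j.reduct N ∧ φ.Realize v ∧ ψ.Realize v := by
  obtain ⟨s, t, hs, ht, rfl, rfl, hst⟩ := h.exists_isGeneric
  -- If one side entails `θ` and the other decides against it, both happen at a common later stage,
  -- where `θ` would separate the pair.
  have key : ∀ θ : L₀.Formula ℕ,
      (∃ n, (s n).Entails (i.onFormula θ)) ↔ ∃ n, (t n).Entails (j.onFormula θ) := by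
    intro θ
    constructor
    · rintro ⟨n, hn⟩
      obtain ⟨m, hm | hm⟩ := ht.decides (j.onFormula θ)
      · exact ⟨m, hm⟩
      · exact (hst (max m n) θ ((hs.entails_of_le _ _ (le_max_right _ _)).trans hn)
          ((ht.entails_of_le _ _ (le_max_left _ _)).trans hm)).elim
    · rintro ⟨n, hn⟩
      obtain ⟨m, hm | hm⟩ := hs.decides (i.onFormula θ)
      · exact ⟨m, hm⟩
      · exact ((hst (max m n)).symm θ ((ht.entails_of_le _ _ (le_max_right _ _)).trans hn)
          ((hs.entails_of_le _ _ (le_max_left _ _)).trans hm)).elim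
  obtain ⟨M, _, v, -, hM⟩ := hs.exists_model
  let r := Setoid.ker v
  have hr : ∀ a b, r a b ↔ ∃ n, (s n).Entails ((Term.var a).equal (Term.var b)) := fun a b => by
    rw [← hM, Formula.realize_equal]
    rfl
  obtain ⟨s₁, h₁⟩ := hs.exists_model_quotient r hr
  -- Equalities between variables belong to the common language, so both models live on the same
  -- quotient.
  obtain ⟨s₂, h₂⟩ := ht.exists_model_quotient r fun a b =>
    (hr a b).trans (key ((Term.var a).equal (Term.var b)))
  refine ⟨ULift.{w} (Quotient r), s₁, s₂, fun n => ULift.up (Quotient.mk r n), ?_,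
    (h₁ _).2 ⟨0, .refl _⟩, (h₂ _).2 ⟨0, .refl _⟩⟩
  refine reduct_eq_of_realize_iff s₁ s₂ (fun n => ULift.up (Quotient.mk r n)) ?_ fun θ => ?_
  · rintro ⟨a⟩
    obtain ⟨n, rfl⟩ := Quotient.exists_rep a
    exact ⟨n, rfl⟩
  · rw [h₁, h₂, key]

/-- **Craig interpolation**: if no structure for the union of the countable languages `L₁` and
`L₂` satisfies both `φ` and `ψ`, then a sentence over the common language `L₀` separates them. -/
theorem exists_separating_sentence [Countable L₁.Symbols] [Countable L₂.Symbols]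
    (φ : L₁.Sentence) (ψ : L₂.Sentence)
    (h : ∀ (N : Type w) [Nonempty N] (_ : L₁.Structure N) (_ : L₂.Structure N),
      i.reduct N = j.reduct N → N ⊨ φ → ¬ N ⊨ ψ) :
    ∃ θ : L₀.Sentence, φ.Entails (i.onSentence θ) ∧ ψ.Entails (j.onSentence θ).not := by
  have hsep : ¬ Inseparable i j (φ.relabel Empty.elim : L₁.Formula ℕ) (ψ.relabel Empty.elim) := by
    intro hi
    obtain ⟨N, s₁, s₂, v, hN, hφ, hψ⟩ := hi.exists_common_model
    rw [Formula.realize_relabel] at hφ hψ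
    have : Nonempty N := ⟨v 0⟩
    refine h N s₁ s₂ hN ?_ ?_
    · exact (Sentence.formulaRealize_iff φ _).1 hφ
    · exact (Sentence.formulaRealize_iff ψ _).1 hψ
  simp only [Inseparable, not_forall, not_not] at hsep
  obtain ⟨θ, h₁, h₂⟩ := hsep
  -- The separator `θ` may have free variables, but `φ` and `ψ` have none, so its entailments hold
  -- under every assignment. All variables can thus be identified and the single one bound.
  refine ⟨iExs Unit (θ.relabel fun _ => Sum.inr ()), entails_of_realize fun M _ _ v hv => ?_,
    entails_of_realize fun M _ _ v hv => ?_⟩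
  · let := i.reduct M
    obtain ⟨a⟩ := ‹Nonempty M›
    refine (LHom.realize_onFormula ..).2 (Formula.realize_iExs_unit.2 ⟨a, ?_⟩)
    rw [Formula.realize_relabel]
    refine (LHom.realize_onFormula ..).1 (h₁.realize (Formula.realize_relabel.2 ?_))
    exact (Sentence.formulaRealize_iff φ _).2 ((Sentence.formulaRealize_iff φ v).1 hv)
  · let := j.reduct M
    refine Formula.realize_not.2 fun hθ => ?_
    obtain ⟨a, ha⟩ := Formula.realize_iExs_unit.1 ((LHom.realize_onFormula ..).1 hθ)
    rw [Formula.realize_relabel] at ha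
    refine Formula.realize_not.1 (h₂.realize (Formula.realize_relabel.2 ?_))
      ((LHom.realize_onFormula ..).2 ha)
    exact (Sentence.formulaRealize_iff ψ _).2 ((Sentence.formulaRealize_iff ψ v).1 hv)

end Interpolation

end FirstOrder.Language

namespace FirstOrder.Language

/-! ### Reduction to finitely many symbols -/

section Sublanguage

variable {L : Language.{u, v}}

/-- The language whose symbols are those symbols of `L` that belong to `S`. -/
def sublanguage (S : Set L.Symbols) : Language.{u, v} where
  Functions n := {f : L.Functions n // Sum.inl ⟨n, f⟩ ∈ S}
  Relations n := {R : L.Relations n // Sum.inr ⟨n, R⟩ ∈ S}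

/-- The inclusion of a sublanguage. -/
def sublanguageInclusion (S : Set L.Symbols) : sublanguage S →ᴸ L where
  onFunction _ f := f.1
  onRelation _ R := R.1

theorem sublanguageInclusion_injective (S : Set L.Symbols) :
    (sublanguageInclusion S).Injective :=
  ⟨fun h => Subtype.ext h, fun h => Subtype.ext h⟩

theorem countable_symbols_sublanguage {S : Set L.Symbols} (hS : S.Countable) :
    Countable (sublanguage S).Symbols := by
  have := hS.to_subtype
  let g : (sublanguage S).Symbols → S :=
    Sum.elim (fun f => ⟨Sum.inl ⟨f.1, f.2.1⟩, f.2.2⟩) (fun R => ⟨Sum.inr ⟨R.1, R.2.1⟩, R.2.2⟩)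
  refine Function.Injective.countable (f := g) ?_
  rintro (⟨n, f, hf⟩ | ⟨n, f, hf⟩) (⟨m, g, hg⟩ | ⟨m, g, hg⟩) h
  · obtain ⟨rfl, h⟩ := Sigma.mk.inj (Sum.inl.inj (congrArg Subtype.val h))
    cases h
    rfl
  · cases congrArg Subtype.val h
  · cases congrArg Subtype.val h
  · obtain ⟨rfl, h⟩ := Sigma.mk.inj (Sum.inr.inj (congrArg Subtype.val h))
    cases h
    rfl

theorem countable_symbols_sum {L' : Language} [Countable L.Symbols] [Countable L'.Symbols] :
    Countable (L.sum L').Symbols := by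
  have h₁ : ∀ n, Countable (L.Functions n) := fun n =>
    (Sum.inl_injective.comp sigma_mk_injective : Function.Injective
      fun f : L.Functions n => (Sum.inl ⟨n, f⟩ : L.Symbols)).countable
  have h₂ : ∀ n, Countable (L'.Functions n) := fun n =>
    (Sum.inl_injective.comp sigma_mk_injective : Function.Injective
      fun f : L'.Functions n => (Sum.inl ⟨n, f⟩ : L'.Symbols)).countable
  have h₃ : ∀ n, Countable (L.Relations n) := fun n =>
    (Sum.inr_injective.comp sigma_mk_injective : Function.Injective
      fun f : L.Relations n => (Sum.inr ⟨n, f⟩ : L.Symbols)).countable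
  have h₄ : ∀ n, Countable (L'.Relations n) := fun n =>
    (Sum.inr_injective.comp sigma_mk_injective : Function.Injective
      fun f : L'.Relations n => (Sum.inr ⟨n, f⟩ : L'.Symbols)).countable
  have h₅ : Countable (Σ n, L.Functions n ⊕ L'.Functions n) := inferInstance
  have h₆ : Countable (Σ n, L.Relations n ⊕ L'.Relations n) := inferInstance
  exact inferInstanceAs
    (Countable ((Σ n, L.Functions n ⊕ L'.Functions n) ⊕ Σ n, L.Relations n ⊕ L'.Relations n))

variable {L' : Language} {α : Type*}

/-- The inclusion of the sum of a sublanguage of `L` with `L'` into the sum of `L` with `L'`. -/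
abbrev sublanguageSumInclusion (S : Set L.Symbols) (L' : Language) :
    (sublanguage S).sum L' →ᴸ L.sum L' :=
  (sublanguageInclusion S).sumMap (LHom.id L')

/-- Allowing every larger `S'` lets the finite sets found for subexpressions be merged by union. -/
theorem Term.exists_finite_sublanguage (t : (L.sum L').Term α) :
    ∃ S : Set L.Symbols, S.Finite ∧ ∀ S', S ⊆ S' →
      ∃ t₀, (sublanguageSumInclusion S' L').onTerm t₀ = t := by
  induction t with
  | var a => exact ⟨∅, Set.finite_empty, fun S' _ => ⟨Term.var a, rfl⟩⟩
  | @func n f ts ih =>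
    choose S hS h using ih
    rcases f with f | f
    · refine ⟨insert (Sum.inl ⟨n, f⟩) (⋃ l, S l), (Set.finite_iUnion hS).insert _,
        fun S' hS' => ?_⟩
      choose t₀ ht₀ using fun l => h l S' fun x hx =>
        hS' (Set.mem_insert_of_mem _ (Set.mem_iUnion.2 ⟨l, hx⟩))
      exact ⟨Term.func (Sum.inl ⟨f, hS' (Set.mem_insert _ _)⟩) t₀,
        congrArg (Term.func _) (funext ht₀)⟩
    · refine ⟨⋃ l, S l, Set.finite_iUnion hS, fun S' hS' => ?_⟩
      choose t₀ ht₀ using fun l => h l S' fun x hx => hS' (Set.mem_iUnion.2 ⟨l, hx⟩)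
      exact ⟨Term.func (Sum.inr f) t₀, congrArg (Term.func _) (funext ht₀)⟩

/-- A formula uses only finitely many symbols. -/
theorem BoundedFormula.exists_finite_sublanguage {k : ℕ} (φ : (L.sum L').BoundedFormula α k) :
    ∃ S : Set L.Symbols, S.Finite ∧ ∀ S', S ⊆ S' →
      ∃ φ₀, (sublanguageSumInclusion S' L').onBoundedFormula φ₀ = φ := by
  induction φ with
  | falsum => exact ⟨∅, Set.finite_empty, fun S' _ => ⟨falsum, rfl⟩⟩
  | equal t₁ t₂ =>
    obtain ⟨S₁, hS₁, h₁⟩ := t₁.exists_finite_sublanguage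
    obtain ⟨S₂, hS₂, h₂⟩ := t₂.exists_finite_sublanguage
    refine ⟨S₁ ∪ S₂, hS₁.union hS₂, fun S' hS' => ?_⟩
    obtain ⟨t₁', rfl⟩ := h₁ S' (Set.subset_union_left.trans hS')
    obtain ⟨t₂', rfl⟩ := h₂ S' (Set.subset_union_right.trans hS')
    exact ⟨equal t₁' t₂', rfl⟩
  | @rel n l R ts =>
    choose S hS h using fun l => (ts l).exists_finite_sublanguage
    rcases R with R | R
    · refine ⟨insert (Sum.inr ⟨l, R⟩) (⋃ l, S l), (Set.finite_iUnion hS).insert _,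
        fun S' hS' => ?_⟩
      choose t₀ ht₀ using fun l => h l S' fun x hx =>
        hS' (Set.mem_insert_of_mem _ (Set.mem_iUnion.2 ⟨l, hx⟩))
      exact ⟨rel (Sum.inl ⟨R, hS' (Set.mem_insert _ _)⟩) t₀, congrArg (rel _) (funext ht₀)⟩
    · refine ⟨⋃ l, S l, Set.finite_iUnion hS, fun S' hS' => ?_⟩
      choose t₀ ht₀ using fun l => h l S' fun x hx => hS' (Set.mem_iUnion.2 ⟨l, hx⟩)
      exact ⟨rel (Sum.inr R) t₀, congrArg (rel _) (funext ht₀)⟩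
  | imp φ₁ φ₂ ih₁ ih₂ =>
    obtain ⟨S₁, hS₁, h₁⟩ := ih₁
    obtain ⟨S₂, hS₂, h₂⟩ := ih₂
    refine ⟨S₁ ∪ S₂, hS₁.union hS₂, fun S' hS' => ?_⟩
    obtain ⟨φ₁', rfl⟩ := h₁ S' (Set.subset_union_left.trans hS')
    obtain ⟨φ₂', rfl⟩ := h₂ S' (Set.subset_union_right.trans hS')
    exact ⟨imp φ₁' φ₂', rfl⟩
  | all φ ih =>
    obtain ⟨S, hS, h⟩ := ih
    refine ⟨S, hS, fun S' hS' => ?_⟩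
    obtain ⟨φ', rfl⟩ := h S' hS'
    exact ⟨all φ', rfl⟩

end Sublanguage

end FirstOrder.Language

/-! ### From interpolation to second-order definability -/

namespace SecondOrder

open FirstOrder FirstOrder.Language

instance {n : ℕ} (arity : Fin n → ℕ) : Countable (relVars arity).Symbols :=
  inferInstanceAs (Countable ((Σ _ : ℕ, Empty) ⊕ Σ k, {i : Fin n // arity i = k}))

variable {L : FirstOrder.Language.{u, v}} {n : ℕ} {arity : Fin n → ℕ}

theorem satisfiesMatrix_onSentence {L₀ : FirstOrder.Language} (g : L₀ →ᴸ L)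
    (φ : (L₀.sum (relVars arity)).Sentence) (M : Type w) [L₀.Structure M] [L.Structure M]
    [g.IsExpansionOn M] (R : (i : Fin n) → (Fin (arity i) → M) → Prop) :
    SatisfiesMatrix ((g.sumMap (LHom.id _)).onSentence φ) M R ↔ SatisfiesMatrix φ M R := by
  let : (relVars arity).Structure M := assignment R
  exact LHom.realize_onSentence M _ φ

theorem SatisfiesMatrix.realize_of_entails {φ : (L.sum (relVars arity)).Sentence} {θ : L.Sentence}
    (h : Formula.Entails φ (LHom.sumInl.onSentence θ)) {M : Type w} [L.Structure M] [Nonempty M]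
    {R : (i : Fin n) → (Fin (arity i) → M) → Prop} (hφ : SatisfiesMatrix φ M R) : M ⊨ θ := by
  let : (relVars arity).Structure M := assignment R
  exact (LHom.realize_onSentence M LHom.sumInl θ).1 (h.realize hφ)

theorem satisfiesMatrix_not {φ : (L.sum (relVars arity)).Sentence} {M : Type w} [L.Structure M]
    {R : (i : Fin n) → (Fin (arity i) → M) → Prop} :
    SatisfiesMatrix φ.not M R ↔ ¬ SatisfiesMatrix φ M R :=
  Iff.rfl

/-- Every structure for the language with relation variables comes from an assignment. -/
theorem exists_satisfiesMatrix_iff {N : Type w} (s : (L.sum (relVars arity)).Structure N) :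
    letI : L.Structure N := (LHom.sumInl : L →ᴸ L.sum (relVars arity)).reduct N
    ∃ R : (i : Fin n) → (Fin (arity i) → N) → Prop,
      ∀ φ : (L.sum (relVars arity)).Sentence, SatisfiesMatrix φ N R ↔ N ⊨ φ := by
  let R : (i : Fin n) → (Fin (arity i) → N) → Prop := fun i xs =>
    s.RelMap (Sum.inr ⟨i, rfl⟩ : (L.sum (relVars arity)).Relations (arity i)) xs
  refine ⟨R, fun φ => ?_⟩
  have hs : @FirstOrder.Language.sumStructure L (relVars arity) N
      ((LHom.sumInl : L →ᴸ L.sum (relVars arity)).reduct N) (assignment R) = s := by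
    ext k f xs
    · rcases f with f | f
      · rfl
      · exact f.elim
    · rcases f with f | ⟨i, rfl⟩
      · rfl
      · rfl
  unfold SatisfiesMatrix
  rw [hs]

theorem exists_separating_foDefinable {K K' : StructureClass.{u, v, w} L}
    (hK : ExistsSODefinable K) (hK' : ForallSODefinable K') (h : K ⊆ K') :
    ∃ K'' : StructureClass.{u, v, w} L, FODefinable K'' ∧ K ⊆ K'' ∧ K'' ⊆ K' := by
  obtain ⟨⟨n, a, φ⟩, hK⟩ := hK
  obtain ⟨⟨m, b, ψ⟩, hK'⟩ := hK'
  simp only [ExistsSOSentence.Realize] at hK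
  simp only [ForallSOSentence.Realize] at hK'
  obtain ⟨S₁, hS₁, h₁⟩ := BoundedFormula.exists_finite_sublanguage φ
  obtain ⟨S₂, hS₂, h₂⟩ := BoundedFormula.exists_finite_sublanguage ψ
  obtain ⟨S, hS, hS₁, hS₂⟩ : ∃ S : Set L.Symbols, S.Finite ∧ S₁ ⊆ S ∧ S₂ ⊆ S :=
    ⟨S₁ ∪ S₂, hS₁.union hS₂, Set.subset_union_left, Set.subset_union_right⟩
  obtain ⟨φ₀, rfl⟩ := h₁ S hS₁
  obtain ⟨ψ₀, rfl⟩ := h₂ S hS₂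
  have := countable_symbols_sublanguage hS.countable
  have : Countable ((sublanguage S).sum (relVars a)).Symbols := countable_symbols_sum
  have : Countable ((sublanguage S).sum (relVars b)).Symbols := countable_symbols_sum
  let g := sublanguageInclusion S
  have hg : ∀ {n : ℕ} {arity : Fin n → ℕ} (χ : ((sublanguage S).sum (relVars arity)).Sentence)
      (M : Type w) [(sublanguage S).Structure M] [L.Structure M] [g.IsExpansionOn M]
      (R : (i : Fin n) → (Fin (arity i) → M) → Prop),
      SatisfiesMatrix ((sublanguageSumInclusion S (relVars arity)).onBoundedFormula χ) M R ↔
        SatisfiesMatrix χ M R := fun χ M _ _ _ R => satisfiesMatrix_onSentence g χ M R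
  obtain ⟨θ, hθ, hθ'⟩ := exists_separating_sentence.{w} (i := LHom.sumInl) (j := LHom.sumInl)
    φ₀ ψ₀.not (by
      intro N _ s₁ s₂ hs hφ hψ
      obtain ⟨R₁, hR₁⟩ := exists_satisfiesMatrix_iff s₁
      obtain ⟨R₂, hR₂⟩ := exists_satisfiesMatrix_iff s₂
      -- Both families of relations now live over one and the same base structure.
      rw [← hs] at hR₂
      classical
      let : Inhabited N := Classical.inhabited_of_nonempty ‹_›
      let : (sublanguage S).Structure N :=
        (LHom.sumInl : sublanguage S →ᴸ (sublanguage S).sum (relVars a)).reduct N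
      -- Symbols outside `S` get arbitrary interpretations; neither matrix mentions them.
      let : L.Structure N := g.defaultExpansion N
      have : g.IsExpansionOn N :=
        (sublanguageInclusion_injective S).isExpansionOn_default N
      let M := Theory.ModelType.of (∅ : L.Theory) N
      have hM : M ∈ K := (hK M).2 ⟨R₁, (hg φ₀ N R₁).2 ((hR₁ φ₀).2 hφ)⟩
      exact (hR₂ ψ₀.not).2 hψ ((hg ψ₀ N R₂).1 ((hK' M).1 (h hM) R₂)))
  refine ⟨{M | M ⊨ g.onSentence θ}, ⟨_, fun M => Iff.rfl⟩, fun M hM => ?_, fun M hM => ?_⟩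
  · let := g.reduct M
    obtain ⟨R, hR⟩ := (hK M).1 hM
    exact (LHom.realize_onSentence M g θ).2 (((hg φ₀ M R).1 hR).realize_of_entails hθ)
  · let := g.reduct M
    refine (hK' M).2 fun R => (hg ψ₀ M R).2 ?_
    by_contra hR
    exact SatisfiesMatrix.realize_of_entails (θ := θ.not) hθ' (satisfiesMatrix_not.2 hR)
      ((LHom.realize_onSentence M g θ).1 hM)

end SecondOrder

theorem mainTheorem4 (L : FirstOrder.Language.{u, v}) :
    (∀ K : SecondOrder.StructureClass.{u, v, w} L,
      SecondOrder.ExistsSODefinable K → SecondOrder.ForallSODefinable K →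
        SecondOrder.FODefinable K) ∧
    (∀ K K' : SecondOrder.StructureClass.{u, v, w} L,
      SecondOrder.ExistsSODefinable K → SecondOrder.ForallSODefinable K' → K ⊆ K' →
        ∃ K'' : SecondOrder.StructureClass.{u, v, w} L,
          SecondOrder.FODefinable K'' ∧ K ⊆ K'' ∧ K'' ⊆ K') := by
  refine ⟨fun K hK hK' => ?_, fun K K' hK hK' h =>
    SecondOrder.exists_separating_foDefinable hK hK' h⟩
  obtain ⟨K'', hK'', h₁, h₂⟩ := SecondOrder.exists_separating_foDefinable hK hK' subset_rfl
  rwa [h₁.antisymm h₂]
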